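/- Let $n\ge 2$. There is a constant $C$ depending only on $n$ such that for every locally finite (positive) Borel measure $\mu$ on $\mathbb R^n$ and every real-valued $f\in C_c^\infty(\mathbb R^n)$, $$\int_{\mathbb R^n}|I_1f|\,d\mu\;\le\; C\int_{\mathbb R^n}|\mathbf Rf(x)|\,M_1\mu(x)\,dx .$$ Both sides are allowed to be $+\infty$, with the convention $0\cdot\infty=0$. Here $$I_1f(x)=\frac1{\gamma(1)}\int_{\mathbb R^n}\frac{f(y)}{|x-y|^{n-1}}\,dy,\qquad \gamma(\alpha)=\frac{2^{\alpha}\pi^{n/2}\,\Gamma(\alpha/2)}{\Gamma((n-\alpha)/2)},$$ is the Riesz potential of order $1$, $\mathbf Rf=-\nabla I_1f$ is the vector Riesz transform (with $|\cdot|$ the Euclidean norm), and $$M_1\mu(x)=\sup_{r>0}\, r\,\frac{\mu(B_r(x))}{|B_r(x)|}$$ is the fractional maximal function of order $1$ of $\mu$, where $|B_r(x)|$ is the Lebesgue measure of the ball $B_r(x)$. -/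

import Mathlib

open MeasureTheory
open scoped ContDiff ENNReal NNReal Gradient

noncomputable section

/-- The normalising constant `γ(α) = 2^α π^(n/2) Γ(α/2) / Γ((n-α)/2)` of the Riesz potential of
order `α` on `ℝⁿ`. -/
def rieszGamma (n : ℕ) (α : ℝ) : ℝ :=
  2 ^ α * Real.pi ^ ((n : ℝ) / 2) * Real.Gamma (α / 2) / Real.Gamma (((n : ℝ) - α) / 2)

theorem rieszGamma_pos {n : ℕ} {α : ℝ} (h0 : 0 < α) (hn : α < n) : 0 < rieszGamma n α := by
  have h1 : 0 < Real.Gamma (α / 2) := Real.Gamma_pos_of_pos (by linarith)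
  have h2 : 0 < Real.Gamma (((n : ℝ) - α) / 2) := Real.Gamma_pos_of_pos (by linarith)
  have h3 := Real.pi_pos
  unfold rieszGamma
  positivity

/-- The Riesz potential `I_α f (x) = γ(α)⁻¹ ∫ f(y) / |x - y|^(n-α) dy` on `ℝⁿ`, `0 < α < n`. -/
def rieszPotential {n : ℕ} (α : ℝ) (f : EuclideanSpace ℝ (Fin n) → ℝ)
    (x : EuclideanSpace ℝ (Fin n)) : ℝ :=
  1 / rieszGamma n α * ∫ y, f y / ‖x - y‖ ^ ((n : ℝ) - α)

/-- The kernel of `I_1` is locally integrable. -/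
theorem locallyIntegrable_rieszKernel {n : ℕ} (hn : 2 ≤ n) :
    LocallyIntegrable (fun z : EuclideanSpace ℝ (Fin n) => (‖z‖ ^ ((n : ℝ) - 1))⁻¹) := by
  refine locallyIntegrable_of_norm_le_rpow (C := 1) (α := (n : ℝ) - 1) ?_ ?_ ?_ ?_
  · rw [finrank_euclideanSpace_fin]
    omega
  · rw [finrank_euclideanSpace_fin]
    linarith
  · refine Filter.Eventually.of_forall fun z => ?_
    rw [one_mul, Real.rpow_neg (norm_nonneg z), Real.norm_of_nonneg (by positivity)]
  · exact (measurable_norm.pow_const _).inv.aestronglyMeasurable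

/-- For `f ∈ C_c^∞(ℝⁿ)`, `n ≥ 2`, the integral that defines `I_1 f (x)` converges absolutely. -/
theorem integrable_rieszPotential {n : ℕ} (hn : 2 ≤ n) {f : EuclideanSpace ℝ (Fin n) → ℝ}
    (hf : ContDiff ℝ ∞ f) (hc : HasCompactSupport f) (x : EuclideanSpace ℝ (Fin n)) :
    Integrable (fun y => f y / ‖x - y‖ ^ ((n : ℝ) - 1)) := by
  have h := (hc.convolutionExists_left (ContinuousLinearMap.mul ℝ ℝ) hf.continuous
    (locallyIntegrable_rieszKernel hn)) x
  exact h

/-- For `f ∈ C_c^∞(ℝⁿ)`, `n ≥ 2`, the potential `I_1 f` is smooth, so its gradient is the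
classical one. -/
theorem contDiff_rieszPotential {n : ℕ} (hn : 2 ≤ n) {f : EuclideanSpace ℝ (Fin n) → ℝ}
    (hf : ContDiff ℝ ∞ f) (hc : HasCompactSupport f) :
    ContDiff ℝ ∞ (rieszPotential 1 f) := by
  have h := hc.contDiff_convolution_left (ContinuousLinearMap.mul ℝ ℝ) hf
    (locallyIntegrable_rieszKernel hn)
  exact contDiff_const.mul h

/-- The vector Riesz transform `R f = -∇ I_1 f` on `ℝⁿ`, `n ≥ 2`. -/
def rieszTransform {n : ℕ} (f : EuclideanSpace ℝ (Fin n) → ℝ)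
    (x : EuclideanSpace ℝ (Fin n)) : EuclideanSpace ℝ (Fin n) :=
  -∇ (rieszPotential 1 f) x

/-- The fractional maximal function `M_α μ (x) = sup_{r > 0} r^α μ(B_r(x)) / |B_r(x)|` of a
measure on `ℝⁿ`, with values in `[0, ∞]`. -/
def fracMaximal {n : ℕ} (α : ℝ) (μ : Measure (EuclideanSpace ℝ (Fin n)))
    (x : EuclideanSpace ℝ (Fin n)) : ℝ≥0∞ :=
  ⨆ (r : ℝ) (_ : 0 < r),
    ENNReal.ofReal (r ^ α) * (μ (Metric.ball x r) / volume (Metric.ball x r))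

end

/-! Only two properties of `u = I_1 f` matter: it is `C¹` and it vanishes at infinity, and `|∇u| =
|Rf|`. By the layer cake formula and the coarea formula, applied to `u` and `-u`, the claim reduces
to a boxing-type inequality `μ(E) ≤ C ∫_{∂E} M_1 μ` for bounded open `E`. To prove that, each point
of `E` gets a ball `B` in which both `E` and its complement have a fixed share of the volume
(`exists_closedBall_density`). The relative isoperimetric inequality bounds `|B| / r` by the
perimeter of `E` in `B`, and `M_1 μ` is at least a multiple of `r μ(5B) / |B|` throughout `B`; hence
`μ(5B) ≤ C ∫_{B ∩ ∂E} M_1 μ`. A Vitali covering adds these up.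

Perimeter is never defined: it is replaced by `liminf ∫ |∇v_k|` along `C¹` functions `v_k → 1_E`.
The coarea formula is replaced by `v_k = S(k(u - t))`, with `S` a smooth step, and Fatou's lemma. -/

/-! ### A Poincaré inequality on balls -/

theorem enorm_sub_le_lintegral_fderiv {V : Type*} [NormedAddCommGroup V] [NormedSpace ℝ V]
    {v : V → ℝ} (hv : ContDiff ℝ 1 v) (x w : V) :
    ‖v (x + w) - v x‖ₑ ≤ ∫⁻ s in Set.Ioc (0 : ℝ) 1, ‖fderiv ℝ v (x + s • w)‖ₑ * ‖w‖ₑ := by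
  have hd : ∀ s : ℝ, HasDerivAt (fun s : ℝ => v (x + s • w)) (fderiv ℝ v (x + s • w) w) s := by
    intro s
    have h1 : HasDerivAt (fun s : ℝ => x + s • w) w s := by
      simpa using ((hasDerivAt_id s).smul_const w).const_add x
    exact ((hv.differentiable one_ne_zero _).hasFDerivAt).comp_hasDerivAt s h1
  have hc : Continuous fun s : ℝ => fderiv ℝ v (x + s • w) w :=
    ((hv.continuous_fderiv one_ne_zero).comp (by fun_prop)).clm_apply continuous_const
  have h := intervalIntegral.integral_eq_sub_of_hasDerivAt (a := 0) (b := 1)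
    (fun s _ => hd s) (hc.intervalIntegrable _ _)
  simp only [one_smul, zero_smul, add_zero] at h
  rw [← h, intervalIntegral.integral_of_le zero_le_one]
  refine (enorm_integral_le_lintegral_enorm _).trans (lintegral_mono fun s => ?_)
  exact ContinuousLinearMap.le_opENorm _ _

theorem volume_closedBall_mul {n : ℕ} (x y : EuclideanSpace ℝ (Fin n)) {a r : ℝ} (ha : 0 ≤ a)
    (hr : 0 ≤ r) :
    volume (Metric.closedBall y (a * r)) = ENNReal.ofReal a ^ n * volume (Metric.closedBall x r) := by
  rw [Measure.addHaar_closedBall _ _ hr, Measure.addHaar_closedBall _ _ (by positivity),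
    finrank_euclideanSpace_fin, mul_pow, ENNReal.ofReal_mul (by positivity),
    ENNReal.ofReal_pow ha, mul_assoc]

theorem lintegral_lintegral_enorm_sub_le {n : ℕ} {v : EuclideanSpace ℝ (Fin n) → ℝ}
    (hv : ContDiff ℝ 1 v) (c : EuclideanSpace ℝ (Fin n)) {r : ℝ} (hr : 0 ≤ r) :
    ∫⁻ x in Metric.closedBall c r, ∫⁻ y in Metric.closedBall c r, ‖v y - v x‖ₑ
      ≤ 2 ^ n * ENNReal.ofReal (2 * r) * volume (Metric.closedBall c r) *
        ∫⁻ x in Metric.closedBall c r, ‖fderiv ℝ v x‖ₑ := by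
  set B := Metric.closedBall c r with hB
  set D := Metric.closedBall (0 : EuclideanSpace ℝ (Fin n)) (2 * r) with hD
  have hBm : MeasurableSet B := measurableSet_closedBall
  have hDm : MeasurableSet D := measurableSet_closedBall
  set G : EuclideanSpace ℝ (Fin n) → ℝ≥0∞ := B.indicator fun x => ‖fderiv ℝ v x‖ₑ with hG
  have hGm : Measurable G :=
    (hv.continuous_fderiv one_ne_zero).enorm.measurable.indicator hBm
  -- Two points of `B` differ by some `w` with `‖w‖ ≤ 2r`, so `K w` dominates the factor `‖w‖`.
  set K : EuclideanSpace ℝ (Fin n) → ℝ≥0∞ := D.indicator fun _ => ENNReal.ofReal (2 * r) with hK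
  have hKm : Measurable K := measurable_const.indicator hDm
  have hpt : ∀ x ∈ B, ∀ w, B.indicator (fun y => ‖v y - v x‖ₑ) (x + w)
      ≤ ∫⁻ s in Set.Ioc (0 : ℝ) 1, K w * G (x + s • w) := by
    intro x hx w
    by_cases hw : x + w ∈ B
    · rw [Set.indicator_of_mem hw]
      refine (enorm_sub_le_lintegral_fderiv hv x w).trans ?_
      refine setLIntegral_mono' measurableSet_Ioc fun s hs => ?_
      have hseg : x + s • w ∈ B := by
        have := (convex_closedBall c r).add_smul_sub_mem hx hw ⟨hs.1.le, hs.2⟩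
        rwa [add_sub_cancel_left] at this
      have hwn : ‖w‖ ≤ 2 * r := by
        have h1 := Metric.mem_closedBall.1 hx
        have h2 := Metric.mem_closedBall.1 hw
        have h3 := dist_triangle_right (x + w) x c
        rw [dist_self_add_left] at h3
        linarith
      rw [hG, hK, Set.indicator_of_mem hseg, Set.indicator_of_mem (by simpa [hD] using hwn),
        mul_comm, ← ofReal_norm]
      gcongr
    · rw [Set.indicator_of_notMem hw]
      exact zero_le
  have hmeas : Measurable fun p : (EuclideanSpace ℝ (Fin n) × EuclideanSpace ℝ (Fin n)) × ℝ =>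
      K p.1.2 * G (p.1.1 + p.2 • p.1.2) := by fun_prop
  calc ∫⁻ x in B, ∫⁻ y in B, ‖v y - v x‖ₑ
      = ∫⁻ x in B, ∫⁻ w, B.indicator (fun y => ‖v y - v x‖ₑ) (x + w) := by
        refine lintegral_congr fun x => ?_
        rw [lintegral_add_left_eq_self (fun y => B.indicator (fun y => ‖v y - v x‖ₑ) y) x,
          lintegral_indicator hBm]
    _ ≤ ∫⁻ x in B, ∫⁻ w, ∫⁻ s in Set.Ioc (0 : ℝ) 1, K w * G (x + s • w) :=
        setLIntegral_mono' hBm fun x hx => lintegral_mono fun w => hpt x hx w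
    _ ≤ ∫⁻ x, ∫⁻ w, ∫⁻ s in Set.Ioc (0 : ℝ) 1, K w * G (x + s • w) :=
        setLIntegral_le_lintegral _ _
    _ = ∫⁻ w, ∫⁻ x, ∫⁻ s in Set.Ioc (0 : ℝ) 1, K w * G (x + s • w) :=
        lintegral_lintegral_swap (hmeas.lintegral_prod_right').aemeasurable
    -- For fixed `w` and `s`, translation invariance in `x` removes the shift `s • w`.
    _ = ∫⁻ w, K w * ∫⁻ x in B, ‖fderiv ℝ v x‖ₑ := by
        refine lintegral_congr fun w => ?_
        rw [lintegral_lintegral_swap]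
        · have : ∀ s : ℝ, ∫⁻ x, K w * G (x + s • w) = K w * ∫⁻ x in B, ‖fderiv ℝ v x‖ₑ := by
            intro s
            rw [lintegral_const_mul _ (by fun_prop), lintegral_add_right_eq_self G,
              lintegral_indicator hBm]
          simp [this]
        · exact Measurable.aemeasurable (by fun_prop)
    _ = 2 ^ n * ENNReal.ofReal (2 * r) * volume B * ∫⁻ x in B, ‖fderiv ℝ v x‖ₑ := by
        rw [lintegral_mul_const _ hKm, lintegral_indicator hDm, setLIntegral_const, hD,
          volume_closedBall_mul c 0 zero_le_two hr, ENNReal.ofReal_ofNat]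
        ring

/-! ### Balls of intermediate density and the relative isoperimetric inequality -/

theorem exists_closedBall_density {n : ℕ} (hn : n ≠ 0) {E : Set (EuclideanSpace ℝ (Fin n))}
    (hE : IsOpen E) {R : ℝ} (hER : E ⊆ Metric.closedBall 0 R) {x : EuclideanSpace ℝ (Fin n)}
    (hx : x ∈ E) :
    ∃ r, 0 < r ∧ r ≤ 4 * R ∧
      volume (Metric.closedBall x r) ≤ 2 ^ (n + 1) * volume (Metric.closedBall x r ∩ E) ∧
      volume (Metric.closedBall x r) ≤ 2 * volume (Metric.closedBall x r \ E) := by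
  obtain ⟨ρ, hρ, hρE⟩ := Metric.nhds_basis_closedBall.mem_iff.1 (hE.mem_nhds hx)
  have hR : 0 ≤ R := (norm_nonneg x).trans (by simpa using hER hx)
  set m : ℝ → ℝ≥0∞ := fun r => volume (Metric.closedBall x r) with hm
  have hdouble : ∀ r : ℝ, 0 ≤ r → m (2 * r) = 2 ^ n * m r := by
    intro r hr
    simp only [hm, volume_closedBall_mul x x zero_le_two hr, ENNReal.ofReal_ofNat]
  -- a ball in which `E` has more than half of the volume is small
  have hsmall : ∀ r : ℝ, 0 ≤ r → m r < 2 * volume (Metric.closedBall x r ∩ E) → r ≤ 2 * R := by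
    intro r hr h
    by_contra! hlt
    have h1 : volume (Metric.closedBall x r ∩ E) ≤
        volume (Metric.closedBall (0 : EuclideanSpace ℝ (Fin n)) R) :=
      measure_mono (Set.inter_subset_right.trans hER)
    have h2 : 2 * volume (Metric.closedBall (0 : EuclideanSpace ℝ (Fin n)) R) ≤ m r := by
      calc 2 * volume (Metric.closedBall (0 : EuclideanSpace ℝ (Fin n)) R)
          ≤ 2 ^ n * volume (Metric.closedBall (0 : EuclideanSpace ℝ (Fin n)) R) := by
            gcongr
            exact le_self_pow₀ one_le_two hn
        _ = volume (Metric.closedBall x (2 * R)) := by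
            rw [volume_closedBall_mul 0 x zero_le_two hR, ENNReal.ofReal_ofNat]
        _ ≤ m r := measure_mono (Metric.closedBall_subset_closedBall hlt.le)
    exact absurd (h.trans_le ((mul_le_mul_right h1 2).trans h2)) (lt_irrefl _)
  -- Stop at the first dyadic radius where `E` fills at most half of the ball. One step earlier it
  -- fills more than half, so doubling costs only `2 ^ n` in density, and the final radius is at
  -- most `2 * (2 * R)`.
  let p : ℕ → Prop := fun j =>
    2 * volume (Metric.closedBall x (2 ^ j * ρ) ∩ E) ≤ m (2 ^ j * ρ)
  have hp : ∃ j, p j := by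
    by_contra! h
    obtain ⟨j, hj⟩ := pow_unbounded_of_one_lt (2 * R / ρ) one_lt_two
    have := hsmall (2 ^ j * ρ) (by positivity) (not_le.1 (h j))
    rw [div_lt_iff₀ hρ] at hj
    linarith
  classical
  obtain ⟨j, hj, hmin⟩ : ∃ j, p j ∧ ∀ i < j, ¬ p i := ⟨Nat.find hp, Nat.find_spec hp,
    fun i hi => Nat.find_min hp hi⟩
  have hj0 : j ≠ 0 := by
    rintro rfl
    have h1 : 2 * m ρ ≤ m ρ := by
      have := hj
      simp only [p, pow_zero, one_mul] at this
      rwa [Set.inter_eq_left.2 hρE] at this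
    have h0 : m ρ ≠ 0 := (Metric.measure_closedBall_pos _ _ hρ).ne'
    have ht : m ρ ≠ ⊤ := measure_closedBall_lt_top.ne
    rw [two_mul] at h1
    exact absurd h1 (not_le.2 (ENNReal.lt_add_right ht h0))
  obtain ⟨i, rfl⟩ := Nat.exists_eq_succ_of_ne_zero hj0
  have hi : m (2 ^ i * ρ) < 2 * volume (Metric.closedBall x (2 ^ i * ρ) ∩ E) :=
    not_le.1 (hmin i (Nat.lt_succ_self i))
  have heq : (2 : ℝ) ^ (i + 1) * ρ = 2 * (2 ^ i * ρ) := by ring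
  refine ⟨2 ^ (i + 1) * ρ, by positivity, ?_, ?_, ?_⟩
  · have := hsmall _ (by positivity) hi
    linarith
  · calc m (2 ^ (i + 1) * ρ) = 2 ^ n * m (2 ^ i * ρ) := by
          rw [heq, hdouble _ (by positivity)]
      _ ≤ 2 ^ n * (2 * volume (Metric.closedBall x (2 ^ i * ρ) ∩ E)) := by gcongr
      _ = 2 ^ (n + 1) * volume (Metric.closedBall x (2 ^ i * ρ) ∩ E) := by ring
      _ ≤ 2 ^ (n + 1) * volume (Metric.closedBall x (2 ^ (i + 1) * ρ) ∩ E) := by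
        have h1 : 0 < 2 ^ i * ρ := by positivity
        have h2 : (2 : ℝ) ^ i * ρ ≤ 2 ^ (i + 1) * ρ := by linarith
        have h3 : Metric.closedBall x (2 ^ i * ρ) ⊆ Metric.closedBall x (2 ^ (i + 1) * ρ) :=
          Metric.closedBall_subset_closedBall h2
        exact mul_le_mul_right (measure_mono (Set.inter_subset_inter_left E h3)) _
  · have h1 := measure_inter_add_sdiff (μ := volume) (Metric.closedBall x (2 ^ (i + 1) * ρ))
      hE.measurableSet
    have h2 : 2 * volume (Metric.closedBall x (2 ^ (i + 1) * ρ) ∩ E)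
      ≤ volume (Metric.closedBall x (2 ^ (i + 1) * ρ)) := hj
    have ht : volume (Metric.closedBall x (2 ^ (i + 1) * ρ)) ≠ ⊤ := measure_closedBall_lt_top.ne
    rw [← h1] at h2 ht ⊢
    rw [two_mul] at h2 ⊢
    have h3 := (ENNReal.add_le_add_iff_left (ne_top_of_le_ne_top ht le_self_add)).1 h2
    gcongr

/-- On `(B ∩ E) × (B \ E)` the differences `|v_k y - v_k x|` tend to `1`, so Fatou and the Poincaré
inequality bound `|B ∩ E| |B \ E|`, which is at least `|B|² / 2^(n+2)`. -/
theorem volume_closedBall_le_liminf_lintegral_fderiv {n : ℕ}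
    {v : ℕ → EuclideanSpace ℝ (Fin n) → ℝ} (hv : ∀ k, ContDiff ℝ 1 (v k))
    {E : Set (EuclideanSpace ℝ (Fin n))} (hE : MeasurableSet E)
    (hlim : ∀ x, Filter.Tendsto (fun k => v k x) Filter.atTop (nhds (E.indicator 1 x)))
    {c : EuclideanSpace ℝ (Fin n)} {r : ℝ} (hr : 0 < r)
    (h1 : volume (Metric.closedBall c r) ≤ 2 ^ (n + 1) * volume (Metric.closedBall c r ∩ E))
    (h2 : volume (Metric.closedBall c r) ≤ 2 * volume (Metric.closedBall c r \ E)) :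
    volume (Metric.closedBall c r) ≤ 2 ^ (2 * n + 3) * ENNReal.ofReal r *
      Filter.liminf (fun k => ∫⁻ x in Metric.closedBall c r, ‖fderiv ℝ (v k) x‖ₑ)
        Filter.atTop := by
  set B := Metric.closedBall c r with hB
  have hBm : MeasurableSet B := measurableSet_closedBall
  have hB0 : volume B ≠ 0 := (Metric.measure_closedBall_pos _ _ hr).ne'
  have hBt : volume B ≠ ⊤ := measure_closedBall_lt_top.ne
  have hvc : ∀ k, Continuous (v k) := fun k => (hv k).continuous
  set L := Filter.liminf (fun k => ∫⁻ x in B, ‖fderiv ℝ (v k) x‖ₑ) Filter.atTop with hL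
  have hsep : ∀ x ∈ B ∩ E, ∀ y ∈ B \ E,
      Filter.liminf (fun k => ‖v k y - v k x‖ₑ) Filter.atTop = 1 := by
    intro x hx y hy
    have := ((hlim y).sub (hlim x)).enorm
    rw [Set.indicator_of_notMem hy.2, Set.indicator_of_mem hx.2] at this
    simpa using this.liminf_eq
  have hprod : volume (B ∩ E) * volume (B \ E)
      ≤ 2 ^ n * ENNReal.ofReal (2 * r) * volume B * L := by
    calc volume (B ∩ E) * volume (B \ E)
        = ∫⁻ x in B ∩ E, ∫⁻ y in B \ E, 1 := by
          simp [mul_comm]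
      _ = ∫⁻ x in B ∩ E, ∫⁻ y in B \ E,
            Filter.liminf (fun k => ‖v k y - v k x‖ₑ) Filter.atTop :=
          setLIntegral_congr_fun (hBm.inter hE) fun x hx =>
            setLIntegral_congr_fun (hBm.diff hE) fun y hy => (hsep x hx y hy).symm
      _ ≤ ∫⁻ x in B, ∫⁻ y in B, Filter.liminf (fun k => ‖v k y - v k x‖ₑ) Filter.atTop :=
          lintegral_mono' (Measure.restrict_mono Set.inter_subset_left le_rfl) fun x =>
            lintegral_mono' (Measure.restrict_mono Set.sdiff_subset le_rfl) le_rfl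
      _ ≤ ∫⁻ x in B, Filter.liminf (fun k => ∫⁻ y in B, ‖v k y - v k x‖ₑ) Filter.atTop :=
          lintegral_mono fun x => lintegral_liminf_le fun k =>
            ((hvc k).sub continuous_const).enorm.measurable
      _ ≤ Filter.liminf (fun k => ∫⁻ x in B, ∫⁻ y in B, ‖v k y - v k x‖ₑ) Filter.atTop :=
          lintegral_liminf_le fun k => by
            have : Measurable fun p : EuclideanSpace ℝ (Fin n) × EuclideanSpace ℝ (Fin n) =>
                ‖v k p.2 - v k p.1‖ₑ :=
              (((hvc k).comp continuous_snd).sub ((hvc k).comp continuous_fst)).enorm.measurable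
            exact this.lintegral_prod_right'
      _ ≤ Filter.liminf (fun k => 2 ^ n * ENNReal.ofReal (2 * r) * volume B *
            ∫⁻ x in B, ‖fderiv ℝ (v k) x‖ₑ) Filter.atTop :=
          Filter.liminf_le_liminf (Filter.Eventually.of_forall fun k =>
            lintegral_lintegral_enorm_sub_le (hv k) c hr.le)
      _ = 2 ^ n * ENNReal.ofReal (2 * r) * volume B * L :=
          ENNReal.liminf_const_mul_of_ne_top (by finiteness)
  refine (ENNReal.mul_le_mul_iff_right hB0 hBt).1 ?_
  calc volume B * volume B
      ≤ (2 ^ (n + 1) * volume (B ∩ E)) * (2 * volume (B \ E)) := by gcongr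
    _ = 2 ^ (n + 2) * (volume (B ∩ E) * volume (B \ E)) := by ring
    _ ≤ 2 ^ (n + 2) * (2 ^ n * ENNReal.ofReal (2 * r) * volume B * L) := by gcongr
    _ = volume B * (2 ^ (2 * n + 3) * ENNReal.ofReal r * L) := by
      rw [ENNReal.ofReal_mul zero_le_two, ENNReal.ofReal_ofNat]
      ring

/-! ### The boxing inequality for bounded open sets -/

theorem measure_closedBall_le_fracMaximal {n : ℕ} (μ : Measure (EuclideanSpace ℝ (Fin n)))
    {c y : EuclideanSpace ℝ (Fin n)} {r : ℝ} (hr : 0 < r) (hy : y ∈ Metric.closedBall c r) :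
    ENNReal.ofReal (7 * r) *
      (μ (Metric.closedBall c (5 * r)) / (7 ^ n * volume (Metric.closedBall c r)))
      ≤ fracMaximal 1 μ y := by
  -- The closed `5r`-ball about `c` lies within distance `6r` of `y`; radius `7r` leaves room for
  -- the open ball in `fracMaximal`.
  have h7 : 0 < 7 * r := by positivity
  refine le_trans ?_ (le_iSup₂ (7 * r) h7)
  have hvol : volume (Metric.ball y (7 * r)) ≤ 7 ^ n * volume (Metric.closedBall c r) := by
    rw [← ENNReal.ofReal_ofNat 7, ← volume_closedBall_mul c y (by norm_num) hr.le]
    exact measure_mono Metric.ball_subset_closedBall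
  rw [Real.rpow_one]
  refine mul_le_mul_right (ENNReal.div_le_div (measure_mono fun z hz => ?_) hvol) _
  rw [Metric.mem_closedBall] at hy hz
  rw [Metric.mem_ball]
  have := dist_triangle_right z y c
  linarith

theorem measure_closedBall_le_liminf {n : ℕ} (μ : Measure (EuclideanSpace ℝ (Fin n)))
    [IsLocallyFiniteMeasure μ]
    {v : ℕ → EuclideanSpace ℝ (Fin n) → ℝ} (hv : ∀ k, ContDiff ℝ 1 (v k))
    {E : Set (EuclideanSpace ℝ (Fin n))} (hE : MeasurableSet E)
    (hlim : ∀ x, Filter.Tendsto (fun k => v k x) Filter.atTop (nhds (E.indicator 1 x)))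
    {c : EuclideanSpace ℝ (Fin n)} {r : ℝ} (hr : 0 < r)
    (h1 : volume (Metric.closedBall c r) ≤ 2 ^ (n + 1) * volume (Metric.closedBall c r ∩ E))
    (h2 : volume (Metric.closedBall c r) ≤ 2 * volume (Metric.closedBall c r \ E)) :
    μ (Metric.closedBall c (5 * r)) ≤ 7 ^ n * 2 ^ (2 * n + 3) *
      Filter.liminf (fun k => ∫⁻ x in Metric.closedBall c r,
        ‖fderiv ℝ (v k) x‖ₑ * fracMaximal 1 μ x) Filter.atTop := by
  have hβ := volume_closedBall_le_liminf_lintegral_fderiv hv hE hlim hr h1 h2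
  set B := Metric.closedBall c r with hB
  have hβ0 : volume B ≠ 0 := (Metric.measure_closedBall_pos _ _ hr).ne'
  have hβt : volume B ≠ ⊤ := measure_closedBall_lt_top.ne
  -- Local finiteness makes the constant `a` finite, so that it passes through the liminf and the
  -- integral.
  have hμ : μ (Metric.closedBall c (5 * r)) ≠ ⊤ := (isCompact_closedBall c (5 * r)).measure_ne_top
  have hd0 : 7 ^ n * volume B ≠ 0 := mul_ne_zero (by simp) hβ0
  have hdt : 7 ^ n * volume B ≠ ⊤ := by finiteness
  set a := ENNReal.ofReal (7 * r) * (μ (Metric.closedBall c (5 * r)) / (7 ^ n * volume B)) with ha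
  have hat : a ≠ ⊤ := ENNReal.mul_ne_top ENNReal.ofReal_ne_top (ENNReal.div_ne_top hμ hd0)
  set L := Filter.liminf (fun k => ∫⁻ x in B, ‖fderiv ℝ (v k) x‖ₑ) Filter.atTop with hL
  set L' := Filter.liminf (fun k => ∫⁻ x in B, ‖fderiv ℝ (v k) x‖ₑ * fracMaximal 1 μ x)
    Filter.atTop with hL'
  have haL : a * L ≤ L' := by
    rw [hL, ← ENNReal.liminf_const_mul_of_ne_top hat]
    refine Filter.liminf_le_liminf (Filter.Eventually.of_forall fun k => ?_)
    rw [← lintegral_const_mul' _ _ hat]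
    refine setLIntegral_mono' measurableSet_closedBall fun x hx => ?_
    rw [mul_comm]
    exact mul_le_mul_right (measure_closedBall_le_fracMaximal μ hr hx) _
  have hr0 : ENNReal.ofReal r ≠ 0 := (ENNReal.ofReal_pos.2 hr).ne'
  refine (ENNReal.mul_le_mul_iff_right hr0 ENNReal.ofReal_ne_top).1 ?_
  calc ENNReal.ofReal r * μ (Metric.closedBall c (5 * r))
      ≤ ENNReal.ofReal (7 * r) * μ (Metric.closedBall c (5 * r)) := by
        gcongr
        linarith
    _ = a * (7 ^ n * volume B) := by
        rw [ha, mul_assoc, ENNReal.div_mul_cancel hd0 hdt]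
    _ ≤ a * (7 ^ n * (2 ^ (2 * n + 3) * ENNReal.ofReal r * L)) := by gcongr
    _ = ENNReal.ofReal r * (7 ^ n * 2 ^ (2 * n + 3) * (a * L)) := by ring
    _ ≤ _ := by gcongr

theorem tsum_liminf_le {ι : Type*} (F : ℕ → ι → ℝ≥0∞) :
    ∑' i, Filter.liminf (fun k => F k i) Filter.atTop
      ≤ Filter.liminf (fun k => ∑' i, F k i) Filter.atTop := by
  -- This is Fatou's lemma for the counting measure.
  let _ : MeasurableSpace ι := ⊤
  simp only [← lintegral_count]
  exact lintegral_liminf_le fun k => measurable_from_top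

theorem measure_le_liminf_lintegral_fderiv_mul_fracMaximal {n : ℕ} (hn : n ≠ 0)
    (μ : Measure (EuclideanSpace ℝ (Fin n))) [IsLocallyFiniteMeasure μ]
    {v : ℕ → EuclideanSpace ℝ (Fin n) → ℝ} (hv : ∀ k, ContDiff ℝ 1 (v k))
    {E : Set (EuclideanSpace ℝ (Fin n))} (hE : IsOpen E) {R : ℝ}
    (hER : E ⊆ Metric.closedBall 0 R)
    (hlim : ∀ x, Filter.Tendsto (fun k => v k x) Filter.atTop (nhds (E.indicator 1 x))) :
    μ E ≤ 7 ^ n * 2 ^ (2 * n + 3) *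
      Filter.liminf (fun k => ∫⁻ x, ‖fderiv ℝ (v k) x‖ₑ * fracMaximal 1 μ x) Filter.atTop := by
  choose! r hr hrR h1 h2 using fun x hx => exists_closedBall_density hn hE hER (x := x) hx
  obtain ⟨u, huE, hdisj, hcov⟩ :=
    Vitali.exists_disjoint_subfamily_covering_enlargement_closedBall E id r (4 * R)
      hrR 5 (by norm_num)
  simp only [id] at hdisj hcov
  have hu : u.Countable := hdisj.countable_of_nonempty_interior fun x hx =>
    ⟨x, mem_interior_iff_mem_nhds.2 (Metric.closedBall_mem_nhds x (hr x (huE hx)))⟩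
  have : Countable u := hu.to_subtype
  have hsub : E ⊆ ⋃ b : u, Metric.closedBall (b : EuclideanSpace ℝ (Fin n)) (5 * r b) := by
    intro x hx
    obtain ⟨b, hb, hxb⟩ := hcov x hx
    exact Set.mem_iUnion.2 ⟨⟨b, hb⟩, hxb (Metric.mem_closedBall_self (hr x hx).le)⟩
  calc μ E ≤ ∑' b : u, μ (Metric.closedBall (b : EuclideanSpace ℝ (Fin n)) (5 * r b)) :=
        (measure_mono hsub).trans (measure_iUnion_le _)
    _ ≤ ∑' b : u, 7 ^ n * 2 ^ (2 * n + 3) *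
          Filter.liminf (fun k => ∫⁻ x in Metric.closedBall (b : EuclideanSpace ℝ (Fin n)) (r b),
            ‖fderiv ℝ (v k) x‖ₑ * fracMaximal 1 μ x) Filter.atTop :=
        ENNReal.tsum_le_tsum fun b => measure_closedBall_le_liminf μ hv hE.measurableSet hlim
          (hr b (huE b.2)) (h1 b (huE b.2)) (h2 b (huE b.2))
    _ ≤ _ := by
        rw [ENNReal.tsum_mul_left]
        refine mul_le_mul_right ((tsum_liminf_le _).trans ?_) _
        refine Filter.liminf_le_liminf (Filter.Eventually.of_forall fun k => ?_)
        rw [← lintegral_iUnion (fun b : u => measurableSet_closedBall)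
          (fun a b hab => hdisj a.2 b.2 (Subtype.coe_injective.ne hab))]
        exact setLIntegral_le_lintegral _ _

/-! ### Measurability of the fractional maximal function -/

theorem lowerSemicontinuous_measure_ball {X : Type*} [PseudoMetricSpace X] [MeasurableSpace X]
    (μ : Measure X) (r : ℝ) : LowerSemicontinuous fun x => μ (Metric.ball x r) := by
  intro x c hc
  have hmono : Monotone fun k : ℕ => Metric.ball x (r - 1 / ((k : ℝ) + 1)) := by
    intro i j hij
    refine Metric.ball_subset_ball ?_
    have := Nat.one_div_le_one_div (α := ℝ) hij
    linarith
  have hU : Metric.ball x r = ⋃ k : ℕ, Metric.ball x (r - 1 / ((k : ℝ) + 1)) := by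
    ext y
    simp only [Metric.mem_ball, Set.mem_iUnion]
    constructor
    · intro hy
      obtain ⟨k, hk⟩ := exists_nat_one_div_lt (sub_pos.2 hy)
      exact ⟨k, by linarith⟩
    · rintro ⟨k, hk⟩
      have : 0 < 1 / ((k : ℝ) + 1) := Nat.one_div_pos_of_nat
      linarith
  change c < μ (Metric.ball x r) at hc
  rw [hU, hmono.measure_iUnion, lt_iSup_iff] at hc
  obtain ⟨k, hk⟩ := hc
  filter_upwards [Metric.ball_mem_nhds x (Nat.one_div_pos_of_nat (α := ℝ) (n := k))] with y hy
  refine hk.trans_le (measure_mono (Metric.ball_subset_ball' ?_))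
  rw [Metric.mem_ball'] at hy
  linarith

theorem measurable_fracMaximal {n : ℕ} (μ : Measure (EuclideanSpace ℝ (Fin n))) :
    Measurable (fracMaximal 1 μ) := by
  refine LowerSemicontinuous.measurable ?_
  refine lowerSemicontinuous_iSup fun r => lowerSemicontinuous_iSup fun hr => ?_
  intro x c hc
  have hcont : Continuous fun m : ℝ≥0∞ => ENNReal.ofReal (r ^ (1 : ℝ)) *
      (m / volume (Metric.ball (0 : EuclideanSpace ℝ (Fin n)) r)) :=
    (ENNReal.continuous_const_mul ENNReal.ofReal_ne_top).comp
      (ENNReal.continuous_div_const _ (Metric.measure_ball_pos _ _ hr).ne')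
  have hmono : Monotone fun m : ℝ≥0∞ => ENNReal.ofReal (r ^ (1 : ℝ)) *
      (m / volume (Metric.ball (0 : EuclideanSpace ℝ (Fin n)) r)) := by
    intro a b hab
    simp only
    gcongr
  have := hcont.comp_lowerSemicontinuous (lowerSemicontinuous_measure_ball μ r) hmono x c
  simp only [Function.comp_def] at this
  simp only [Measure.addHaar_ball_center] at hc ⊢
  exact this hc

/-! ### A smoothed coarea formula -/

theorem lintegral_Ioi_deriv_smoothTransition_le {a : ℝ} (ha : 0 < a) (c : ℝ) :
    ∫⁻ t in Set.Ioi (0 : ℝ), ‖a * deriv Real.smoothTransition (a * (c - t))‖ₑ ≤ 1 := by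
  have hS : ∀ s, HasDerivAt Real.smoothTransition (deriv Real.smoothTransition s) s := fun s =>
    ((Real.smoothTransition.contDiff (n := 1)).differentiable one_ne_zero s).hasDerivAt
  have hd : ∀ t, HasDerivAt (fun t => -Real.smoothTransition (a * (c - t)))
      (a * deriv Real.smoothTransition (a * (c - t))) t := by
    intro t
    have h1 : HasDerivAt (fun t => a * (c - t)) (-a) t := by
      simpa using ((hasDerivAt_id t).const_sub c).const_mul a
    have h2 := ((hS (a * (c - t))).comp t h1).neg
    rwa [mul_neg, neg_neg, mul_comm] at h2
  have hnn : ∀ t, 0 ≤ a * deriv Real.smoothTransition (a * (c - t)) := fun t =>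
    mul_nonneg ha.le Real.smoothTransition.monotone.deriv_nonneg
  have hlim : Filter.Tendsto (fun t => -Real.smoothTransition (a * (c - t))) Filter.atTop
      (nhds 0) := by
    refine tendsto_const_nhds.congr' ?_
    filter_upwards [Filter.eventually_ge_atTop c] with t ht
    rw [Real.smoothTransition.zero_of_nonpos, neg_zero]
    exact mul_nonpos_of_nonneg_of_nonpos ha.le (by linarith)
  have hint := integrableOn_Ioi_deriv_of_nonneg' (a := 0) (fun t _ => hd t) (fun t _ => hnn t) hlim
  have hval := integral_Ioi_of_hasDerivAt_of_nonneg' (a := 0) (fun t _ => hd t)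
    (fun t _ => hnn t) hlim
  calc ∫⁻ t in Set.Ioi (0 : ℝ), ‖a * deriv Real.smoothTransition (a * (c - t))‖ₑ
      = ∫⁻ t in Set.Ioi (0 : ℝ), ENNReal.ofReal (a * deriv Real.smoothTransition (a * (c - t))) :=
        lintegral_congr fun t => Real.enorm_of_nonneg (hnn t)
    _ = ENNReal.ofReal (Real.smoothTransition (a * (c - 0))) := by
        rw [← ofReal_integral_eq_lintegral_ofReal hint (Filter.Eventually.of_forall hnn), hval]
        simp
    _ ≤ 1 := ENNReal.ofReal_le_one.2 (Real.smoothTransition.le_one _)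

theorem tendsto_smoothTransition_superlevel {X : Type*} (u : X → ℝ) (t : ℝ) (x : X) :
    Filter.Tendsto (fun k : ℕ => Real.smoothTransition (((k : ℝ) + 1) * (u x - t))) Filter.atTop
      (nhds ({x | t < u x}.indicator 1 x)) := by
  refine tendsto_const_nhds.congr' ?_
  by_cases h : t < u x
  · obtain ⟨m, hm⟩ := exists_nat_gt (1 / (u x - t))
    filter_upwards [Filter.eventually_ge_atTop m] with k hk
    rw [Set.indicator_of_mem (by exact h), Real.smoothTransition.one_of_one_le, Pi.one_apply]
    rw [div_lt_iff₀ (sub_pos.2 h)] at hm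
    have : (m : ℝ) ≤ k := by exact_mod_cast hk
    nlinarith [sub_pos.2 h]
  · refine Filter.Eventually.of_forall fun k => ?_
    rw [Set.indicator_of_notMem (by exact h)]
    refine (Real.smoothTransition.zero_of_nonpos ?_).symm
    exact mul_nonpos_of_nonneg_of_nonpos (by positivity) (by linarith)

theorem enorm_fderiv_smoothTransition_comp {V : Type*} [NormedAddCommGroup V] [NormedSpace ℝ V]
    {u : V → ℝ} (hu : ContDiff ℝ 1 u) (a t : ℝ) (x : V) :
    ‖fderiv ℝ (fun x => Real.smoothTransition (a * (u x - t))) x‖ₑ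
      = ‖a * deriv Real.smoothTransition (a * (u x - t))‖ₑ * ‖fderiv ℝ u x‖ₑ := by
  have hS : HasDerivAt Real.smoothTransition
      (deriv Real.smoothTransition (a * (u x - t))) (a * (u x - t)) :=
    ((Real.smoothTransition.contDiff (n := 1)).differentiable one_ne_zero _).hasDerivAt
  have h1 : HasFDerivAt (fun x => a * (u x - t)) (a • fderiv ℝ u x) x :=
    ((hu.differentiable one_ne_zero x).hasFDerivAt.sub_const t).const_mul a
  have h2 := hS.comp_hasFDerivAt x h1
  rw [show (fun x => Real.smoothTransition (a * (u x - t)))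
    = Real.smoothTransition ∘ fun x => a * (u x - t) from rfl, h2.fderiv, smul_smul, enorm_smul,
    mul_comm (deriv _ _) a]

theorem lintegral_ofReal_le_lintegral_fderiv_mul_fracMaximal {n : ℕ} (hn : n ≠ 0)
    (μ : Measure (EuclideanSpace ℝ (Fin n))) [IsLocallyFiniteMeasure μ]
    {u : EuclideanSpace ℝ (Fin n) → ℝ} (hu : ContDiff ℝ 1 u)
    (hu0 : Filter.Tendsto u (Filter.cocompact _) (nhds 0)) :
    ∫⁻ x, ENNReal.ofReal (u x) ∂μ
      ≤ 7 ^ n * 2 ^ (2 * n + 3) * ∫⁻ x, ‖fderiv ℝ u x‖ₑ * fracMaximal 1 μ x := by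
  have hM := measurable_fracMaximal μ
  have hDu : Measurable fun x => ‖fderiv ℝ u x‖ₑ :=
    (hu.continuous_fderiv one_ne_zero).enorm.measurable
  let S' := deriv Real.smoothTransition
  have hS' : Continuous S' := (Real.smoothTransition.contDiff (n := 1)).continuous_deriv le_rfl
  let F : ℕ → ℝ → EuclideanSpace ℝ (Fin n) → ℝ≥0∞ := fun k t x =>
    ‖((k : ℝ) + 1) * S' (((k : ℝ) + 1) * (u x - t))‖ₑ * ‖fderiv ℝ u x‖ₑ * fracMaximal 1 μ x
  have hF : ∀ k, Measurable fun p : ℝ × EuclideanSpace ℝ (Fin n) => F k p.1 p.2 := by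
    intro k
    have h1 : Continuous fun p : ℝ × EuclideanSpace ℝ (Fin n) =>
        ((k : ℝ) + 1) * S' (((k : ℝ) + 1) * (u p.2 - p.1)) := by
      have := hu.continuous
      fun_prop
    exact (h1.enorm.measurable.mul (hDu.comp measurable_snd)).mul (hM.comp measurable_snd)
  have hlevel : ∀ t ∈ Set.Ioi (0 : ℝ), μ {x | t < u x} ≤ 7 ^ n * 2 ^ (2 * n + 3) *
      Filter.liminf (fun k => ∫⁻ x, F k t x) Filter.atTop := by
    intro t ht
    obtain ⟨R, hR⟩ : ∃ R, {x | t < u x} ⊆ Metric.closedBall 0 R := by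
      have h1 : ∀ᶠ x in Filter.cocompact _, u x < t := hu0.eventually_lt_const ht
      obtain ⟨K, hK, hKs⟩ := Filter.mem_cocompact.1 h1
      obtain ⟨R, hR⟩ := hK.isBounded.subset_closedBall 0
      refine ⟨R, fun x hx => hR ?_⟩
      by_contra hxK
      exact lt_asymm (show t < u x from hx) (hKs hxK : u x < t)
    have hv : ∀ k : ℕ, ContDiff ℝ 1
        fun x => Real.smoothTransition (((k : ℝ) + 1) * (u x - t)) := fun k =>
      Real.smoothTransition.contDiff.comp (contDiff_const.mul (hu.sub contDiff_const))
    have h := measure_le_liminf_lintegral_fderiv_mul_fracMaximal hn μ hv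
      (isOpen_lt continuous_const hu.continuous) hR (tendsto_smoothTransition_superlevel u t)
    simpa only [enorm_fderiv_smoothTransition_comp hu] using h
  calc ∫⁻ x, ENNReal.ofReal (u x) ∂μ = ∫⁻ x, ENNReal.ofReal (max (u x) 0) ∂μ := by
        simp
    _ = ∫⁻ t in Set.Ioi 0, μ {x | t < max (u x) 0} :=
        lintegral_eq_lintegral_meas_lt μ (Filter.Eventually.of_forall fun x => le_max_right _ _)
          (hu.continuous.max continuous_const).measurable.aemeasurable
    _ = ∫⁻ t in Set.Ioi 0, μ {x | t < u x} :=
        setLIntegral_congr_fun measurableSet_Ioi fun t ht => by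
          simp [not_lt.2 (Set.mem_Ioi.1 ht).le]
    _ ≤ ∫⁻ t in Set.Ioi 0, 7 ^ n * 2 ^ (2 * n + 3) *
          Filter.liminf (fun k => ∫⁻ x, F k t x) Filter.atTop :=
        setLIntegral_mono' measurableSet_Ioi hlevel
    _ = 7 ^ n * 2 ^ (2 * n + 3) *
          ∫⁻ t in Set.Ioi 0, Filter.liminf (fun k => ∫⁻ x, F k t x) Filter.atTop :=
        lintegral_const_mul' _ _ (by finiteness)
    _ ≤ 7 ^ n * 2 ^ (2 * n + 3) *
          Filter.liminf (fun k => ∫⁻ t in Set.Ioi 0, ∫⁻ x, F k t x) Filter.atTop := by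
        gcongr
        exact lintegral_liminf_le fun k => (hF k).lintegral_prod_right'
    _ ≤ _ := by
        gcongr
        refine Filter.liminf_le_of_le (by isBoundedDefault) fun b hb => ?_
        obtain ⟨k, hk⟩ := hb.exists
        refine hk.trans ?_
        -- Integrating in `t` first, the smoothed delta at level `u x` has mass at most `1`,
        -- uniformly in `k`.
        rw [lintegral_lintegral_swap (hF k).aemeasurable]
        refine lintegral_mono fun x => ?_
        simp only [F, mul_assoc]
        rw [lintegral_mul_const]
        · exact mul_le_of_le_one_left'
            (lintegral_Ioi_deriv_smoothTransition_le (by positivity) (u x))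
        · have : Continuous fun t : ℝ => ((k : ℝ) + 1) * S' (((k : ℝ) + 1) * (u x - t)) := by
            fun_prop
          exact this.enorm.measurable

/-! ### Decay of the Riesz potential and conclusion -/

theorem tendsto_rieszPotential_cocompact {n : ℕ} (hn : 2 ≤ n) {f : EuclideanSpace ℝ (Fin n) → ℝ}
    (hf : Continuous f) (hc : HasCompactSupport f) :
    Filter.Tendsto (rieszPotential 1 f) (Filter.cocompact _) (nhds 0) := by
  obtain ⟨R, hR⟩ := hc.isCompact.isBounded.subset_closedBall 0
  have hp : 0 < (n : ℝ) - 1 := by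
    have : (2 : ℝ) ≤ n := by exact_mod_cast hn
    linarith
  have hfi : Integrable f := hf.integrable_of_hasCompactSupport hc
  have hnorm := tendsto_norm_cocompact_atTop (E := EuclideanSpace ℝ (Fin n))
  have hlim : Filter.Tendsto (fun x : EuclideanSpace ℝ (Fin n) =>
      |1 / rieszGamma n 1| * ((∫ y, ‖f y‖) / (‖x‖ - R) ^ ((n : ℝ) - 1)))
      (Filter.cocompact _) (nhds 0) := by
    rw [← mul_zero |1 / rieszGamma n 1|]
    exact (Filter.Tendsto.const_div_atTop ((tendsto_rpow_atTop hp).comp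
      (Filter.tendsto_atTop_add_const_right _ (-R) hnorm)) _).const_mul _
  refine squeeze_zero_norm' ?_ hlim
  filter_upwards [hnorm.eventually_gt_atTop R] with x hx
  rw [rieszPotential, norm_mul, Real.norm_eq_abs (1 / _)]
  gcongr
  rw [← integral_div]
  refine norm_integral_le_of_norm_le (hfi.norm.div_const _) (Filter.Eventually.of_forall fun y => ?_)
  by_cases hy : f y = 0
  · simp [hy]
  · have hyR : ‖y‖ ≤ R := by simpa using hR (subset_tsupport f hy)
    rw [norm_div, Real.norm_of_nonneg (by positivity : 0 ≤ ‖x - y‖ ^ ((n : ℝ) - 1))]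
    have h1 : 0 < ‖x‖ - R := by linarith
    have h2 := norm_sub_norm_le x y
    gcongr
    linarith

theorem mainTheorem8 (n : ℕ) (hn : 2 ≤ n) :
    ∃ C : ℝ≥0, ∀ (μ : Measure (EuclideanSpace ℝ (Fin n))) [IsLocallyFiniteMeasure μ]
      (f : EuclideanSpace ℝ (Fin n) → ℝ), ContDiff ℝ ∞ f → HasCompactSupport f →
        ∫⁻ x, ‖rieszPotential 1 f x‖ₑ ∂μ
          ≤ (C : ℝ≥0∞) * ∫⁻ x, ‖rieszTransform f x‖ₑ * fracMaximal 1 μ x := by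
  -- The factor `2` comes from treating the positive and negative parts of `I_1 f` separately.
  refine ⟨2 * (7 ^ n * 2 ^ (2 * n + 3)), fun μ _ f hf hc => ?_⟩
  have hn0 : n ≠ 0 := by omega
  have hu : ContDiff ℝ 1 (rieszPotential 1 f) :=
    (contDiff_rieszPotential hn hf hc).of_le (by simp)
  have hu0 := tendsto_rieszPotential_cocompact hn hf.continuous hc
  have h1 := lintegral_ofReal_le_lintegral_fderiv_mul_fracMaximal hn0 μ hu hu0
  have h2 := lintegral_ofReal_le_lintegral_fderiv_mul_fracMaximal hn0 μ hu.neg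
    (by simpa using hu0.neg)
  have hgrad : ∀ x, ‖rieszTransform f x‖ₑ = ‖fderiv ℝ (rieszPotential 1 f) x‖ₑ := by
    intro x
    rw [rieszTransform, enorm_neg, ← toDual_gradient]
    exact ((InnerProductSpace.toDual ℝ _).enorm_map _).symm
  have hneg : ∀ x, ‖fderiv ℝ (fun x => -rieszPotential 1 f x) x‖ₑ
      = ‖fderiv ℝ (rieszPotential 1 f) x‖ₑ := by
    intro x
    rw [fderiv_fun_neg, enorm_neg]
  have habs : ∀ a : ℝ, ‖a‖ₑ = ENNReal.ofReal a + ENNReal.ofReal (-a) := by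
    intro a
    rcases le_total 0 a with h | h
    · rw [Real.enorm_of_nonneg h, ENNReal.ofReal_of_nonpos (neg_nonpos.2 h), add_zero]
    · rw [← enorm_neg, Real.enorm_of_nonneg (neg_nonneg.2 h), ENNReal.ofReal_of_nonpos h, zero_add]
  simp only [hneg] at h2
  simp only [hgrad, habs (rieszPotential 1 f _)]
  rw [lintegral_add_left hu.continuous.measurable.ennreal_ofReal]
  refine (add_le_add h1 h2).trans_eq ?_
  push_cast
  ring
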